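/- Model. The Congested Clique has $n\ge 1$ nodes in a fully connected synchronous network; in every round each node may send one message of $O(\log n)$ bits to each other node, and local computation is free. For the product of two $n\times n$ matrices $S,T$ over a semiring $R$, the input of node $v$ is row $v$ of $S$ and row $v$ of $T$, and node $v$ has to halt with row $v$ of $P=S\cdot T$ as its output. As messages have $O(\log n)$ bits, it is understood that the nodes share a format in which semiring elements are written as words of at most $c(\lfloor\log_2 n\rfloor+1)$ bits, $c$ a constant, and that the entries of $S$ and $T$ and the partial sums $\sum_{k\in I}S[i][k]\,T[k][j]$ ($I\subseteq[n]$) can be written in it. Let $nz(A)$ be the number of non-zero entries of $A$. Statement. For every $c$ there are a constant $d$ and a deterministic Congested Clique algorithm (Algorithm SMM) with messages of $d(\lfloor\log_2 n\rfloor+1)$ bits, given for every $n$, every semiring and every such format, but not knowing $m$, $nz(S)$ or $nz(T)$ in advance, with the following properties. (1) If $nz(S)$ and $nz(T)$ are both $O(m)$, then it computes $P=S\cdot T$ within $O(m^{2/3}/n+1)$ rounds. That is, for every $\kappa$ there is $C$, depending only on $c$ and $\kappa$, such that for all $n\ge 1$, all semirings, all formats, all $n\times n$ matrices $S,T$ as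 above and all natural numbers $m$ with $nz(S)\le\kappa m$ and $nz(T)\le\kappa m$, all nodes have halted with the correct output within at most $C\,(m^{2/3}/n+1)$ rounds. (2) In particular (the case $m=n^2$), for all $S,T$ as above it computes $S\cdot T$ within $O(n^{1/3})$ rounds, with a constant that depends only on $c$. -/

import Mathlib

universe u

/-- A bit string of length `b`. -/
abbrev Word (b : ℕ) : Type := Fin b → Bool

/-- The number of bits in the binary expansion of `n ≥ 1`; up to constant factors this is `log n`
as soon as `n ≥ 2`. -/
def bitLength (n : ℕ) : ℕ := Nat.log 2 n + 1

/-- A deterministic algorithm in the Congested Clique with `n` nodes (identified with `Fin n`) and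
messages of `b` bits. Node `v` starts in a state that is determined by its own input only. In every
synchronous round each node sends to every node at most one message of `b` bits (`none` is silence),
as a function of its own state, and then updates its state from the messages it has received.
Local computation is unrestricted, as usual in this model. A node halts by producing an output.
(A node's message to itself carries nothing that the node does not already know.) -/
structure CliqueAlgorithm (n b : ℕ) (In Out : Type u) where
  /-- The local states of the nodes. -/
  State : Type u
  /-- The initial state of a node with a given input. -/
  init : Fin n → In → State
  /-- `send v s w` is the message that node `v` in state `s` sends to node `w`. -/
  send : Fin n → State → Fin n → Option (Word b)
  /-- `receive v s μ` is the next state of node `v` in state `s` that receives `μ w` from each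
  node `w`. -/
  receive : Fin n → State → (Fin n → Option (Word b)) → State
  /-- The output of a node, once it has halted. -/
  output : Fin n → State → Option Out

namespace CliqueAlgorithm

variable {n b : ℕ} {In Out : Type u}

/-- The message from `v` to `w` in the current round; a node that has halted is silent. -/
def message (A : CliqueAlgorithm n b In Out) (σ : Fin n → A.State) (v w : Fin n) :
    Option (Word b) :=
  if (A.output v (σ v)).isSome then none else A.send v (σ v) w

/-- One synchronous round; a node that has halted no longer changes its state. -/
def round (A : CliqueAlgorithm n b In Out) (σ : Fin n → A.State) : Fin n → A.State :=
  fun v => if (A.output v (σ v)).isSome then σ v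
    else A.receive v (σ v) (fun w => A.message σ w v)

/-- The states of all the nodes after `t` rounds, when node `v` has input `x v`. -/
def run (A : CliqueAlgorithm n b In Out) (x : Fin n → In) : ℕ → Fin n → A.State
  | 0 => fun v => A.init v (x v)
  | t + 1 => A.round (A.run x t)

/-- On input `x`, within `r` rounds every node `v` has halted, with output `y v`. -/
def ComputesWithin (A : CliqueAlgorithm n b In Out) (x : Fin n → In) (y : Fin n → Out)
    (r : ℕ) : Prop :=
  ∀ v, A.output v (A.run x r v) = some (y v)

end CliqueAlgorithm

/-- The number of non-zero entries of a matrix. -/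
noncomputable def nz {n : ℕ} {R : Type u} [Zero R] (A : Matrix (Fin n) (Fin n) R) : ℕ :=
  {p : Fin n × Fin n | A p.1 p.2 ≠ 0}.ncard

/-- `dec` is a common format of semiring elements as `w`-bit words. The entries of `S` and of `T`
and all partial sums of the sums `∑ k, S i k * T k j` that define the entries of `S * T` are
elements which can be written in this format. -/
def Representable {n w : ℕ} {R : Type u} [Semiring R] (dec : Word w → R)
    (S T : Matrix (Fin n) (Fin n) R) : Prop :=
  (∀ i j, S i j ∈ Set.range dec) ∧ (∀ i j, T i j ∈ Set.range dec) ∧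
    ∀ i j, ∀ I : Finset (Fin n), ∑ k ∈ I, S i k * T k j ∈ Set.range dec

/-- A Congested Clique algorithm for the multiplication of two `n × n` matrices over `R`: the input
of node `v` is row `v` of each of the two matrices, its output is meant to be row `v` of the
product. -/
abbrev MatMulAlgorithm (n b : ℕ) (R : Type u) : Type (u + 1) :=
  CliqueAlgorithm n b ((Fin n → R) × (Fin n → R)) (Fin n → R)

/-- The algorithm computes `S * T` within `r` rounds. -/
def MultipliesWithin {n b : ℕ} {R : Type u} [Semiring R] (A : MatMulAlgorithm n b R)
    (S T : Matrix (Fin n) (Fin n) R) (r : ℕ) : Prop :=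
  A.ComputesWithin (fun v => (S v, T v)) (fun v => (S * T) v) r

universe v

/-!
# Sparse matrix multiplication in the Congested Clique

With `a² l ≈ n` and `O(a³ l³)` non-zero entries in each factor, the rows of `S` and the columns of
`T` are divided into `a` balanced groups each, and the inner dimension of each pair of groups is
divided into `l` intervals of balanced sparsity; one node is responsible for each of the resulting
`a² l` subproducts. All communication takes place in `O(l)` rounds, and is balanced by means of edge
colourings that all nodes can compute from globally known counts.
-/

/-! Let N be the larger of the two numbers of non-zero entries. If a² l ≈ n and N ≈ (a l)³, then l ≈
N^(2/3) / n, so O(l) rounds is the goal. A node is made responsible for a group of rows of `S`, a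
group of columns of `T` and one of l levels of the inner index. Groups have O(a l) members, and for
each group the inner index is cut into intervals with O(a² l²) = O(n l) non-zero entries. For a pair
of groups the two interval numbers f and g are monotone and below l/2, so f + g is below l, and each
of its level sets lies in a single interval of either cut. Hence a node needs O(n l) entries of each
factor and produces O(n l) partial sums, which takes O(l) rounds if the traffic is spread evenly.

Even spreading comes from `exists_balanced_coloring`, the colour of an entry being the node that
stores it. Only counts of non-zero entries are globally known, not positions. So the colouring is
chosen for one reference matrix with the same counts, and every row carries it over to its own
entries by an injection that respects the intervals (`exists_injOn_of_card_fiber_eq`).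

Since local computation is free, a node is described by the instances that it cannot distinguish,
and it can compute whatever is constant on these classes (`Determines`). Communication lemmas for
`Solves` are in continuation form: a step refines the relations, and the rest of the protocol is
supplied for the refined ones. Data known to all nodes are frozen by `Solves.of_fibers`; this is how
a and l can depend on the unknown sparsity. -/

/-! ### Lockstep programs as Congested Clique algorithms -/

/-- The program of a single node: it either halts with a value or sends one word to every node and
continues with the words that it receives. -/
inductive NodeProgram (n b : ℕ) (β : Type u) : Type u
  | ret : β → NodeProgram n b β
  | step : (Fin n → Word b) → ((Fin n → Word b) → NodeProgram n b β) → NodeProgram n b β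

namespace NodeProgram

variable {n b : ℕ} {β In : Type u}

/-- The programs `σ v`, run in lockstep, all halt after exactly `r` rounds, with values `y v`. -/
inductive Runs : (Fin n → NodeProgram n b β) → (Fin n → β) → ℕ → Prop
  | ret (y : Fin n → β) : Runs (fun v => .ret (y v)) y 0
  | step (m : Fin n → Fin n → Word b) (k : Fin n → (Fin n → Word b) → NodeProgram n b β)
      (y : Fin n → β) (r : ℕ) (h : Runs (fun v => k v (fun w => m w v)) y r) :
      Runs (fun v => .step (m v) (k v)) y (r + 1)

/-- The Congested Clique algorithm in which the state of a node is the program still to be run. -/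
def toAlgorithm (P : Fin n → In → NodeProgram n b β) : CliqueAlgorithm n b In β where
  State := NodeProgram n b β
  init := P
  send _ s w := match s with
    | .ret _ => none
    | .step m _ => some (m w)
  receive _ s μ := match s with
    | .ret a => .ret a
    -- In a lockstep run no node falls silent before the others halt, so the default word is never
    -- used.
    | .step _ k => k (fun w => (μ w).getD (fun _ => false))
  output _ s := match s with
    | .ret a => some a
    | .step _ _ => none

theorem run_eq_iterate (A : CliqueAlgorithm n b In β) (x : Fin n → In) (r : ℕ) :
    A.run x r = A.round^[r] (fun v => A.init v (x v)) := by
  induction r with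
  | zero => rfl
  | succ r ih => rw [Function.iterate_succ_apply', ← ih]; rfl

theorem Runs.iterate_round (P : Fin n → In → NodeProgram n b β) {σ : Fin n → NodeProgram n b β}
    {y : Fin n → β} {r : ℕ} (h : Runs σ y r) :
    (toAlgorithm P).round^[r] σ = fun v => NodeProgram.ret (y v) := by
  induction h with
  | ret y => rfl
  | step m k y r _ ih =>
    exact ih

theorem Runs.computesWithin {P : Fin n → In → NodeProgram n b β} {x : Fin n → In}
    {y : Fin n → β} {r : ℕ} (h : Runs (fun v => P v (x v)) y r) :
    (toAlgorithm P).ComputesWithin x y r := by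
  intro v
  rw [run_eq_iterate]
  have := h.iterate_round P
  change (toAlgorithm P).output v ((toAlgorithm P).round^[r] (fun v => P v (x v)) v) = _
  rw [this]
  rfl

end NodeProgram

/-! ### Knowledge of nodes and communication primitives -/

section Knowledge

variable {n b : ℕ} {X : Type*} {β : Type u}

/-- On the instances in `V`, the knowledge `K` (where `K v` relates the instances that node `v`
cannot distinguish) allows each node `v` to compute `f x v`. -/
def Determines {γ : Type*} (V : Set X) (K : Fin n → Setoid X) (f : X → Fin n → γ) : Prop :=
  ∀ v, ∀ x ∈ V, ∀ x' ∈ V, K v x x' → f x v = f x' v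

/-- With initial knowledge `K`, nodes that exchange `b`-bit words can compute the outputs `out x v`
on all instances `x ∈ V` within `B x` rounds. -/
def Solves (b : ℕ) (V : Set X) (K : Fin n → Setoid X) (out : X → Fin n → β)
    (B : X → ℕ) : Prop :=
  ∃ P : X → Fin n → NodeProgram n b β, Determines V K P ∧
    ∀ x ∈ V, ∃ r ≤ B x, NodeProgram.Runs (P x) (out x) r

theorem Determines.mono {γ : Type*} {V V' : Set X} {K K' : Fin n → Setoid X} {f : X → Fin n → γ}
    (h : Determines V K f) (hV : V' ⊆ V) (hK : ∀ v, K' v ≤ K v) : Determines V' K' f :=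
  fun v x hx x' hx' hxx' => h v x (hV hx) x' (hV hx') (hK v hxx')

theorem Solves.mono_bound {V : Set X} {K : Fin n → Setoid X} {out : X → Fin n → β}
    {B B' : X → ℕ} (h : Solves b V K out B) (hB : ∀ x ∈ V, B x ≤ B' x) : Solves b V K out B' := by
  obtain ⟨P, hP, hr⟩ := h
  refine ⟨P, hP, fun x hx => ?_⟩
  obtain ⟨r, h1, h2⟩ := hr x hx
  exact ⟨r, h1.trans (hB x hx), h2⟩

theorem Solves.of_determines {V : Set X} {K : Fin n → Setoid X} {out : X → Fin n → β}
    (h : Determines V K out) : Solves b V K out (fun _ => 0) :=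
  ⟨fun x v => .ret (out x v), fun v x hx x' hx' hK => congrArg _ (h v x hx x' hx' hK),
    fun _ _ => ⟨0, le_rfl, .ret _⟩⟩

/-- Globally known data may be regarded as constants of the algorithm. -/
theorem Solves.of_fibers {V : Set X} {K : Fin n → Setoid X} {out : X → Fin n → β} {B : X → ℕ}
    {Γ : Type*} (γ : X → Γ) (hγ : Determines V K (fun x _ => γ x))
    (h : ∀ x₀ ∈ V, Solves b {x ∈ V | γ x = γ x₀} K out B) : Solves b V K out B := by
  classical
  have h' : ∀ g : Γ, ∃ P : X → Fin n → NodeProgram n b β, Determines {x ∈ V | γ x = g} K P ∧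
      ∀ x ∈ V, γ x = g → ∃ r ≤ B x, NodeProgram.Runs (P x) (out x) r := by
    intro g
    by_cases hg : ∃ x₀ ∈ V, γ x₀ = g
    · obtain ⟨x₀, hx₀, rfl⟩ := hg
      obtain ⟨P, hP, hr⟩ := h x₀ hx₀
      exact ⟨P, hP, fun x hx hxg => hr x ⟨hx, hxg⟩⟩
    · exact ⟨fun x v => .ret (out x v), fun v x hx => (hg ⟨x, hx.1, hx.2⟩).elim,
        fun x hx hxg => (hg ⟨x, hx, hxg⟩).elim⟩
  choose P hP hr using h'
  refine ⟨fun x => P (γ x) x, fun v x hx x' hx' hK => ?_, fun x hx => hr (γ x) x hx rfl⟩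
  have e : γ x = γ x' := hγ v x hx x' hx' hK
  change P (γ x) x v = P (γ x') x' v
  rw [← e]
  exact hP (γ x) v x ⟨hx, rfl⟩ x' ⟨hx', e.symm⟩ hK

/-- One round in which node `v` sends `msg x v w` to node `w`. -/
theorem Solves.exchange [Nonempty β] {V : Set X} {K : Fin n → Setoid X} {out : X → Fin n → β}
    {B : X → ℕ} {M : Type*} [Fintype M] (hM : Fintype.card M ≤ 2 ^ b) (msg : X → Fin n → Fin n → M)
    (hmsg : Determines V K msg)
    (h : ∀ K' : Fin n → Setoid X, (∀ v, K' v ≤ K v) →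
      Determines V K' (fun x v w => msg x w v) → Solves b V K' out B) :
    Solves b V K out (fun x => B x + 1) := by
  classical
  obtain ⟨enc⟩ : Nonempty (M ↪ Word b) := by
    apply Function.Embedding.nonempty_of_card_le
    simpa using hM
  obtain ⟨P, hP, hr⟩ := h (fun v => K v ⊓ Setoid.ker (fun x w => msg x w v))
    (fun v => inf_le_left) (fun v x _ x' _ hK => hK.2)
  -- Reached only on words that no indistinguishable instance of `V` would deliver.
  let fallback : NodeProgram n b β := .ret (Classical.arbitrary β)
  let cont : X → Fin n → (Fin n → Word b) → NodeProgram n b β := fun x v μ =>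
    if hx : ∃ x' ∈ V, K v x x' ∧ ∀ w, μ w = enc (msg x' w v) then P hx.choose v else fallback
  refine ⟨fun x v => .step (fun w => enc (msg x v w)) (cont x v), ?_, ?_⟩
  · intro v x hx x' hx' hK
    have e1 : msg x v = msg x' v := hmsg v x hx x' hx' hK
    have e2 : cont x v = cont x' v := by
      funext μ
      have : ∀ y, K v x y ↔ K v x' y := fun y =>
        ⟨fun h => (K v).trans ((K v).symm hK) h, fun h => (K v).trans hK h⟩
      simp only [cont, this]
    simp only [e1, e2]
  · intro x hx
    obtain ⟨r, hrB, hrun⟩ := hr x hx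
    refine ⟨r + 1, Nat.succ_le_succ hrB, .step _ _ _ _ ?_⟩
    convert hrun using 2 with v
    have hex : ∃ x' ∈ V, K v x x' ∧ ∀ w, enc (msg x w v) = enc (msg x' w v) :=
      ⟨x, hx, (K v).refl x, fun w => rfl⟩
    simp only [cont, dif_pos hex]
    obtain ⟨h1, h2, h3⟩ := hex.choose_spec
    -- The chosen instance may differ from `x`, but it lies in the same class of the refined
    -- relation, where `P` is constant.
    refine (hP v x hx _ h1 ⟨h2, ?_⟩).symm
    funext w
    exact enc.injective (h3 w)

/-- `L` rounds in which node `v` sends the messages `msg l x v w` to node `w`. -/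
theorem Solves.rounds [Nonempty β] {K : Fin n → Setoid X} {V : Set X} {out : X → Fin n → β}
    {B : X → ℕ} {M : Type*} [Fintype M] (hM : Fintype.card M ≤ 2 ^ b) (L : ℕ)
    (msg : ℕ → X → Fin n → Fin n → M) (hmsg : ∀ l < L, Determines V K (msg l))
    (h : ∀ K' : Fin n → Setoid X, (∀ v, K' v ≤ K v) →
      (∀ l < L, Determines V K' (fun x v w => msg l x w v)) → Solves b V K' out B) :
    Solves b V K out (fun x => B x + L) := by
  induction L generalizing K with
  | zero => exact h K (fun v => le_rfl) (fun l hl => absurd hl (Nat.not_lt_zero l))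
  | succ L ih =>
    refine Solves.exchange hM (msg L) (hmsg L L.lt_succ_self) (fun K₁ hK₁ hd₁ => ?_)
    refine ih (fun l hl => (hmsg l (by omega)).mono subset_rfl hK₁) (fun K' hK' hd => ?_)
    refine h K' (fun v => (hK' v).trans (hK₁ v)) (fun l hl => ?_)
    rcases Nat.lt_succ_iff_lt_or_eq.1 hl with hl | rfl
    · exact hd l hl
    · exact hd₁.mono subset_rfl hK'

open Classical in
/-- Suppose that every entry `e` of the vector `A x` that is wanted by some node is owned by some
node, that the owner of an entry knows its value and who wants it, and that no node has to send more
than `L` non-zero entries to the same node. Then all nodes can learn the entries that they want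
within `L` rounds. -/
theorem Solves.sendEntries [Nonempty β] {K : Fin n → Setoid X} {V : Set X} {out : X → Fin n → β}
    {B : X → ℕ} {w : ℕ} {R ι : Type*} [Zero R] [Fintype ι] (dec : Word w → R)
    (hM : Fintype.card (Option (ι × Word w)) ≤ 2 ^ b) (L : ℕ) (A : X → ι → R)
    (hA : ∀ x ∈ V, ∀ e, A x e ∈ Set.range dec) (own want : X → Fin n → ι → Prop)
    (hown : ∀ x ∈ V, ∀ u e, want x u e → ∃ v, own x v e)
    (hK : Determines V K (fun x v u e => if own x v e ∧ want x u e then A x e else 0))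
    (hL : ∀ x ∈ V, ∀ v u,
      (Finset.univ.filter fun e => own x v e ∧ want x u e ∧ A x e ≠ 0).card ≤ L)
    (h : ∀ K' : Fin n → Setoid X, (∀ v, K' v ≤ K v) →
      Determines V K' (fun x u e => if want x u e then A x e else 0) → Solves b V K' out B) :
    Solves b V K out (fun x => B x + L) := by
  let enc : R → Word w := fun a => if ha : a ∈ Set.range dec then ha.choose else fun _ => false
  have henc : ∀ a ∈ Set.range dec, dec (enc a) = a := fun a ha => by
    simp only [enc, dif_pos ha]
    exact ha.choose_spec
  -- The `l`-th non-zero entry with its position. Zeros are never sent: past the end of the list,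
  -- `none` tells the receiver that all other entries vanish.
  let F : (ι → R) → ℕ → Option (ι × Word w) := fun f l =>
    ((Finset.univ.filter fun e => f e ≠ 0).toList[l]?).map (fun e => (e, enc (f e)))
  let G : X → Fin n → Fin n → ι → R := fun x v u e =>
    if own x v e ∧ want x u e then A x e else 0
  have hGA : ∀ x v u e, G x v u e ≠ 0 → own x v e ∧ want x u e ∧ G x v u e = A x e := by
    intro x v u e he
    by_cases hc : own x v e ∧ want x u e
    · exact ⟨hc.1, hc.2, if_pos hc⟩
    · exact absurd (if_neg hc) he
  have key : ∀ f f' : ι → R, (∀ l, F f l = F f' l) → (∀ e, f e ≠ 0 → f e ∈ Set.range dec) →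
      (∀ e, f' e ≠ 0 → f' e ∈ Set.range dec) → ∀ e, f e ≠ 0 → f' e = f e := by
    intro f f' hF hf hf' e he
    have hmem : e ∈ (Finset.univ.filter fun e => f e ≠ 0).toList := by simpa using he
    obtain ⟨l, hl⟩ := List.getElem?_of_mem hmem
    have h1 : F f l = some (e, enc (f e)) := by simp only [F, hl, Option.map_some]
    rw [hF l] at h1
    simp only [F, Option.map_eq_some_iff] at h1
    obtain ⟨e', he', h2⟩ := h1
    have h3 := Prod.mk.inj h2
    obtain rfl : e' = e := h3.1
    have h4 : f' e' ≠ 0 := by simpa using List.mem_of_getElem? he'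
    rw [← henc _ (hf e' he), ← henc _ (hf' e' h4), h3.2]
  refine Solves.rounds hM L (fun l x v u => F (G x v u) l) (fun l _ v x hx x' hx' hxx' => ?_)
    (fun K' hK' hd => h K' hK' ?_)
  · have : G x v = G x' v := hK v x hx x' hx' hxx'
    simp only [this]
  · intro u x hx x' hx' hxx'
    have hFG : ∀ v l, F (G x v u) l = F (G x' v u) l := by
      intro v l
      rcases lt_or_ge l L with hl | hl
      · exact congrFun (hd l hl u x hx x' hx' hxx') v
      -- By `hL` no list is longer than `L`, so nothing is lost after `L` rounds.
      · have big : ∀ y ∈ V, F (G y v u) l = none := by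
          intro y hy
          simp only [F, Option.map_eq_none_iff, List.getElem?_eq_none_iff, Finset.length_toList]
          refine le_trans (Finset.card_le_card ?_) ((hL y hy v u).trans hl)
          intro e he
          simp only [Finset.mem_filter, Finset.mem_univ, true_and] at he ⊢
          obtain ⟨h1, h2, h3⟩ := hGA y v u e he
          exact ⟨h1, h2, h3 ▸ he⟩
        rw [big x hx, big x' hx']
    have hr : ∀ y ∈ V, ∀ v e, G y v u e ≠ 0 → G y v u e ∈ Set.range dec := fun y hy v e he => by
      rw [(hGA y v u e he).2.2]
      exact hA y hy e
    -- Only entries that are non-zero in the first instance can be traced; hence the use in both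
    -- directions.
    have half : ∀ y ∈ V, ∀ y' ∈ V, (∀ v l, F (G y v u) l = F (G y' v u) l) → ∀ e,
        (if want y u e then A y e else 0) ≠ 0 →
        (if want y' u e then A y' e else 0) = (if want y u e then A y e else 0) := by
      intro y hy y' hy' hF e he
      have hw : want y u e := by
        by_contra hw
        exact he (if_neg hw)
      obtain ⟨v, hv⟩ := hown y hy u e hw
      have h1 : G y v u e = A y e := if_pos ⟨hv, hw⟩
      rw [if_pos hw] at he ⊢
      have h2 := key _ _ (hF v) (hr y hy v) (hr y' hy' v) e (h1 ▸ he)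
      have h3 := hGA y' v u e (by rw [h2, h1]; exact he)
      rw [if_pos h3.2.1, ← h3.2.2, h2, h1]
    funext e
    by_cases he : (if want x u e then A x e else 0) = 0
    · by_contra hne
      have he' : (if want x' u e then A x' e else 0) ≠ 0 := fun h0 => hne (he.trans h0.symm)
      exact hne (half x' hx' x hx (fun v l => (hFG v l).symm) e he')
    · exact (half x hx x' hx' hFG e he).symm

end Knowledge

/-! ### Balanced colourings and interval cuts -/

section Combinatorics

open Finset

/-- Greedy colouring of the elements of `E` that is balanced on the fibres of two maps at once. -/
theorem exists_balanced_coloring {ε α β : Type v} [DecidableEq ε] [DecidableEq α] [DecidableEq β]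
    {n Lf Lg tf tg : ℕ} (hf : 2 * Lf < n * tf) (hg : 2 * Lg < n * tg) (f : ε → α) (g : ε → β)
    (E : Finset ε) (hfE : ∀ a, (E.filter fun e => f e = a).card ≤ Lf)
    (hgE : ∀ a, (E.filter fun e => g e = a).card ≤ Lg) :
    ∃ col : ε → Fin n, (∀ a w, (E.filter fun e => f e = a ∧ col e = w).card ≤ tf) ∧
      ∀ a w, (E.filter fun e => g e = a ∧ col e = w).card ≤ tg := by
  -- On a single fibre fewer than half of the colours are used up. A new element lies in one fibre
  -- of each map, so some colour is free for both.
  have full : ∀ {γ : Type v} [DecidableEq γ] (h : ε → γ) (a : γ) (E : Finset ε) (col : ε → Fin n)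
      (L t : ℕ), 2 * L < n * t → (E.filter fun e => h e = a).card ≤ L →
      2 * (univ.filter fun w => t ≤ (E.filter fun e => h e = a ∧ col e = w).card).card < n := by
    intro γ _ h a E col L t hL hE
    set F := univ.filter fun w => t ≤ (E.filter fun e => h e = a ∧ col e = w).card
    have h1 : F.card * t ≤ L := by
      calc F.card * t ≤ ∑ w ∈ F, (E.filter fun e => h e = a ∧ col e = w).card := by
            rw [← smul_eq_mul]
            exact card_nsmul_le_sum _ _ _ (fun w hw => (mem_filter.1 hw).2)
        _ ≤ ∑ w, (E.filter fun e => h e = a ∧ col e = w).card :=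
            sum_le_sum_of_subset (subset_univ _)
        _ = (E.filter fun e => h e = a).card := by
            rw [card_eq_sum_card_fiberwise (f := col) (t := univ) (fun _ _ => mem_univ _)]
            simp only [filter_filter]
        _ ≤ L := hE
    by_contra hcon
    have : n * t ≤ 2 * F.card * t := Nat.mul_le_mul_right t (not_lt.1 hcon)
    nlinarith
  have hn : 0 < n := by
    rcases Nat.eq_zero_or_pos n with h | h
    · subst h; omega
    · exact h
  induction E using Finset.induction_on with
  | empty => exact ⟨fun _ => ⟨0, hn⟩, by simp, by simp⟩
  | insert e E he ih =>
    obtain ⟨col, hcf, hcg⟩ := ih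
      (fun a => (card_le_card (filter_subset_filter _ (subset_insert e E))).trans (hfE a))
      (fun a => (card_le_card (filter_subset_filter _ (subset_insert e E))).trans (hgE a))
    have h1 := full f (f e) E col Lf tf hf
      ((card_le_card (filter_subset_filter _ (subset_insert e E))).trans (hfE _))
    have h2 := full g (g e) E col Lg tg hg
      ((card_le_card (filter_subset_filter _ (subset_insert e E))).trans (hgE _))
    obtain ⟨c, hc⟩ : ∃ c : Fin n, c ∉ (univ.filter fun w =>
        tf ≤ (E.filter fun e' => f e' = f e ∧ col e' = w).card) ∪ (univ.filter fun w =>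
        tg ≤ (E.filter fun e' => g e' = g e ∧ col e' = w).card) := by
      by_contra hcon
      push Not at hcon
      have h3 := card_le_card (fun c _ => hcon c : (univ : Finset (Fin n)) ⊆ _)
      have h4 := h3.trans (card_union_le _ _)
      rw [card_univ, Fintype.card_fin] at h4
      omega
    simp only [mem_union, mem_filter, mem_univ, true_and, not_or, not_le] at hc
    have step : ∀ {γ : Type v} [DecidableEq γ] (h : ε → γ) (t : ℕ),
        (∀ a w, (E.filter fun e => h e = a ∧ col e = w).card ≤ t) →
        (E.filter fun e' => h e' = h e ∧ col e' = c).card < t → ∀ a w,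
        ((insert e E).filter fun e' => h e' = a ∧ Function.update col e c e' = w).card ≤ t := by
      intro γ _ h t h1 h2 a w
      have hcongr : (E.filter fun e' => h e' = a ∧ Function.update col e c e' = w) =
          E.filter fun e' => h e' = a ∧ col e' = w := by
        refine filter_congr fun e' he' => ?_
        rw [Function.update_of_ne (ne_of_mem_of_not_mem he' he)]
      rw [filter_insert, hcongr]
      split_ifs with hcase
      · rw [Function.update_self] at hcase
        obtain ⟨rfl, rfl⟩ := hcase
        exact (card_insert_le _ _).trans h2
      · exact h1 a w
    exact ⟨Function.update col e c, step f tf hcf hc.1, step g tg hcg hc.2⟩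

/-- The sum of the weights of the elements before `k`. -/
def prefixSum {n : ℕ} (ω : Fin n → ℕ) (k : Fin n) : ℕ := ∑ k' ∈ Iio k, ω k'

theorem prefixSum_mono {n : ℕ} (ω : Fin n → ℕ) : Monotone (prefixSum ω) := fun _ _ h =>
  sum_le_sum_of_subset (Iio_subset_Iio h)

theorem prefixSum_le {n : ℕ} (ω : Fin n → ℕ) (k : Fin n) : prefixSum ω k ≤ ∑ k', ω k' :=
  sum_le_sum_of_subset (subset_univ _)

/-- Cutting `Fin n` into intervals of weight about `D`. -/
theorem sum_prefixSum_div_eq_le {n D M : ℕ} (ω : Fin n → ℕ) (hω : ∀ k, ω k ≤ M) (hD : 0 < D)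
    (r : ℕ) : ∑ k with prefixSum ω k / D = r, ω k ≤ D + M := by
  set F := univ.filter fun k => prefixSum ω k / D = r
  rcases F.eq_empty_or_nonempty with hF | hF
  · simp [hF]
  set a := F.min' hF
  set z := F.max' hF
  have ha : prefixSum ω a / D = r := (mem_filter.1 (F.min'_mem hF)).2
  have hz : prefixSum ω z / D = r := (mem_filter.1 (F.max'_mem hF)).2
  -- The prefix sums in one class lie in [D r, D (r + 1)), so all members but the last weigh less
  -- than `D` together; the last adds at most `M`.
  have h1 : ∑ k ∈ F.erase z, ω k + prefixSum ω a ≤ prefixSum ω z := by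
    unfold prefixSum
    rw [← sum_union]
    · refine sum_le_sum_of_subset fun k hk => ?_
      rw [mem_Iio]
      rcases mem_union.1 hk with hk | hk
      · exact lt_of_le_of_ne (F.le_max' k (mem_of_mem_erase hk)) (ne_of_mem_erase hk)
      · exact (mem_Iio.1 hk).trans_le (F.min'_le z (F.max'_mem hF))
    · refine disjoint_left.2 fun k hk hk' => ?_
      exact absurd (F.min'_le k (mem_of_mem_erase hk)) (not_le.2 (mem_Iio.1 hk'))
  have h2 : ∑ k ∈ F, ω k = ∑ k ∈ F.erase z, ω k + ω z :=
    (sum_erase_add F ω (F.max'_mem hF)).symm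
  have h3 := hω z
  have h4 : prefixSum ω z < D * (r + 1) := by
    rw [← hz]; exact Nat.lt_mul_div_succ _ hD
  have h5 : D * r ≤ prefixSum ω a := by
    rw [← ha]; exact Nat.mul_div_le _ _
  have h6 : D * (r + 1) = D * r + D := by ring
  omega

/-- A monotone function is determined by its jumps. -/
theorem lt_card_filter_le_iff {n : ℕ} {h : Fin n → ℕ} (hh : Monotone h) (k : Fin n) (r : ℕ) :
    (k : ℕ) < (univ.filter fun k' => h k' ≤ r).card ↔ h k ≤ r := by
  constructor
  · intro hk
    by_contra hcon
    have : (univ.filter fun k' => h k' ≤ r) ⊆ Iio k := by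
      intro k' hk'
      rw [mem_Iio]
      by_contra h0
      exact hcon ((hh (not_lt.1 h0)).trans (mem_filter.1 hk').2)
    have := card_le_card this
    rw [Fin.card_Iio] at this
    omega
  · intro hk
    have : Iic k ⊆ (univ.filter fun k' => h k' ≤ r) := fun k' hk' =>
      mem_filter.2 ⟨mem_univ _, (hh (mem_Iic.1 hk')).trans hk⟩
    have := card_le_card this
    rw [Fin.card_Iic] at this
    omega

/-- If two functions take every value equally often on two subsets, there is a value-preserving
injection of the one into the other. -/
theorem exists_injOn_of_card_fiber_eq {κ : Type*} [DecidableEq κ] (h : κ → ℕ) (s t : Finset κ)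
    (hst : ∀ r, (s.filter fun k => h k = r).card = (t.filter fun k => h k = r).card) :
    ∃ σ : κ → κ, Set.InjOn σ s ∧ ∀ k ∈ s, σ k ∈ t ∧ h (σ k) = h k := by
  have e : ∀ r, Nonempty ((s.filter fun k => h k = r) ≃ (t.filter fun k => h k = r)) := fun r =>
    ⟨Finset.equivOfCardEq (hst r)⟩
  have hmem : ∀ k : κ, k ∈ s → k ∈ s.filter fun k' => h k' = h k := fun k hk =>
    mem_filter.2 ⟨hk, rfl⟩
  let σ : κ → κ := fun k => if hk : k ∈ s then (e (h k)).some ⟨k, hmem k hk⟩ else k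
  have hσ : ∀ k ∈ s, σ k ∈ t ∧ h (σ k) = h k := by
    intro k hk
    have : σ k = (e (h k)).some ⟨k, hmem k hk⟩ := dif_pos hk
    rw [this]
    exact mem_filter.1 ((e (h k)).some ⟨k, hmem k hk⟩).2
  refine ⟨σ, fun k hk k' hk' hkk' => ?_, hσ⟩
  have hh : h k = h k' := by rw [← (hσ k hk).2, ← (hσ k' hk').2, hkk']
  have e1 : σ k = (e (h k)).some ⟨k, hmem k hk⟩ := dif_pos hk
  have e2 : σ k' = (e (h k)).some ⟨k', mem_filter.2 ⟨hk', hh.symm⟩⟩ := by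
    have : ∀ r (hr : k' ∈ s.filter fun k'' => h k'' = r), h k' = r →
        σ k' = (e r).some ⟨k', hr⟩ := by
      rintro _ hr rfl
      exact dif_pos hk'
    exact this _ _ hh.symm
  rw [e1, e2] at hkk'
  exact congrArg Subtype.val ((e (h k)).some.injective (Subtype.val_injective hkk'))

end Combinatorics

/-! ### Groups of rows and layers of columns -/

section Partition

open Finset
open scoped Classical

variable {n a l : ℕ} {R : Type*} [Zero R]

/-- The rows of a sparse matrix can be divided into `a` groups of about the same size with about the
same number of non-zero entries. -/
theorem exists_grouping (ha : 0 < a) (hl : 0 < l) (hn : n ≤ 2 * (a ^ 2 * l)) (s : Fin n → ℕ)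
    (hs : ∀ i, s i ≤ n) (hsum : ∑ i, s i ≤ 8 * (a ^ 3 * l ^ 3)) :
    ∃ p : Fin n → Fin a, (∀ P, #{i | p i = P} ≤ 14 * (a * l)) ∧
      ∀ P, ∑ i with p i = P, s i ≤ 14 * (a ^ 2 * l ^ 3) := by
  -- The constant summand lets one cut balance two quantities: weight 14 a² l³ leaves room for at
  -- most 14 a l rows.
  let ω : Fin n → ℕ := fun i => s i + a * l ^ 2
  have hω : ∑ i, ω i ≤ 10 * (a ^ 3 * l ^ 3) := by
    simp only [ω, sum_add_distrib, sum_const, card_univ, Fintype.card_fin, smul_eq_mul]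
    nlinarith [Nat.mul_le_mul_right (a * l ^ 2) hn]
  -- The total weight is at most 10 a³ l³, so cutting at multiples of 11 a² l³ gives indices below
  -- `a`. A single weight is at most 3 a² l³, and 11 + 3 = 14.
  have hD : 0 < 11 * (a ^ 2 * l ^ 3) := by positivity
  have hlt : ∀ i, prefixSum ω i / (11 * (a ^ 2 * l ^ 3)) < a := by
    intro i
    rw [Nat.div_lt_iff_lt_mul hD]
    have := (prefixSum_le ω i).trans hω
    have h1 : 0 < a ^ 3 * l ^ 3 := by positivity
    nlinarith
  have hM : ∀ i, ω i ≤ 3 * (a ^ 2 * l ^ 3) := by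
    intro i
    have h1 : a * l ^ 2 ≤ a ^ 2 * l ^ 3 :=
      Nat.mul_le_mul (Nat.le_self_pow two_ne_zero a) (Nat.pow_le_pow_right hl (by norm_num))
    have h2 : a ^ 2 * l ≤ a ^ 2 * l ^ 3 := Nat.mul_le_mul_left _ (Nat.le_self_pow three_ne_zero l)
    have := hs i
    simp only [ω]
    omega
  refine ⟨fun i => ⟨_, hlt i⟩, fun P => ?_, fun P => ?_⟩
  all_goals
    have key := sum_prefixSum_div_eq_le ω hM hD (P : ℕ)
    simp only [Fin.ext_iff]
    simp only [ω, sum_add_distrib, sum_const, smul_eq_mul] at key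
  · have : 0 < a * l ^ 2 := by positivity
    refine Nat.le_of_mul_le_mul_right (c := a * l ^ 2) ?_ this
    calc _ ≤ 11 * (a ^ 2 * l ^ 3) + 3 * (a ^ 2 * l ^ 3) := le_trans (Nat.le_add_left _ _) key
      _ = _ := by ring
  · exact le_trans (Nat.le_add_right _ _) (key.trans (by omega))

/-- The number of non-zero entries of column `k` of `A` in the rows of group `P`. -/
noncomputable def groupCount (p : Fin n → Fin a) (A : Matrix (Fin n) (Fin n) R) (P : Fin a)
    (k : Fin n) : ℕ :=
  #{i | p i = P ∧ A i k ≠ 0}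

/-- The division of the columns of the rows of group `P` into intervals, the layers, with about
`29 a² l²` non-zero entries in each of them. -/
noncomputable def layer (l : ℕ) (p : Fin n → Fin a) (A : Matrix (Fin n) (Fin n) R) (P : Fin a)
    (k : Fin n) : ℕ :=
  prefixSum (groupCount p A P) k / (29 * (a ^ 2 * l ^ 2))

theorem layer_mono (p : Fin n → Fin a) (A : Matrix (Fin n) (Fin n) R) (P : Fin a) :
    Monotone (layer l p A P) :=
  fun _ _ h => Nat.div_le_div_right (prefixSum_mono _ h)

theorem groupCount_le (p : Fin n → Fin a) (A : Matrix (Fin n) (Fin n) R) (P : Fin a) (k : Fin n) :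
    groupCount p A P k ≤ #{i | p i = P} :=
  card_le_card fun i => by
    simp only [mem_filter, mem_univ, true_and]
    exact And.left

theorem sum_groupCount (p : Fin n → Fin a) (A : Matrix (Fin n) (Fin n) R) (P : Fin a)
    (F : Finset (Fin n)) : ∑ k ∈ F, groupCount p A P k =
      #{e : Fin n × Fin n | p e.1 = P ∧ e.2 ∈ F ∧ A e.1 e.2 ≠ 0} := by
  rw [card_eq_sum_card_fiberwise (f := Prod.snd) (t := F)]
  · refine sum_congr rfl fun k hk => ?_
    refine card_bij (fun i _ => (i, k)) ?_ ?_ ?_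
    · intro i hi
      simp only [mem_filter, mem_univ, true_and] at hi ⊢
      exact ⟨⟨hi.1, hk, hi.2⟩, trivial⟩
    · intro i _ j _ hij
      exact congrArg Prod.fst hij
    · rintro ⟨i, k'⟩ hi
      simp only [mem_filter, mem_univ, true_and] at hi
      obtain ⟨⟨h1, -, h2⟩, rfl⟩ := hi
      exact ⟨i, by simp [h1, h2], rfl⟩
  · intro e he
    simp only [coe_filter, mem_univ, true_and, Set.mem_ofPred_eq] at he
    exact he.2.1

theorem sum_groupCount_eq_sum (p : Fin n → Fin a) (A : Matrix (Fin n) (Fin n) R) (P : Fin a) :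
    ∑ k, groupCount p A P k = ∑ i with p i = P, #{k | A i k ≠ 0} := by
  simp only [groupCount, card_filter, sum_filter]
  rw [sum_comm]
  refine sum_congr rfl fun i _ => ?_
  by_cases h : p i = P <;> simp [h]

/-- As 2 · 14 < 29, cutting at multiples of 29 a² l² keeps the index below l/2. The factor 2 keeps
the sum of a layer of `S` and a layer of `T` below `l`. -/
theorem two_mul_layer_lt {p : Fin n → Fin a} {A : Matrix (Fin n) (Fin n) R} {P : Fin a}
    (ha : 0 < a) (hl : 0 < l) (h : ∑ i with p i = P, #{k | A i k ≠ 0} ≤ 14 * (a ^ 2 * l ^ 3))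
    (k : Fin n) : 2 * layer l p A P k < l := by
  have h1 := (prefixSum_le (groupCount p A P) k).trans ((sum_groupCount_eq_sum p A P).trans_le h)
  have h2 : layer l p A P k * (29 * (a ^ 2 * l ^ 2)) ≤ 14 * (a ^ 2 * l ^ 3) :=
    (Nat.div_mul_le_self _ _).trans h1
  have h3 : 0 < a ^ 2 * l ^ 2 := by positivity
  have h4 : (layer l p A P k * 29) * (a ^ 2 * l ^ 2) ≤ (14 * l) * (a ^ 2 * l ^ 2) := by
    calc _ = layer l p A P k * (29 * (a ^ 2 * l ^ 2)) := by ring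
      _ ≤ _ := h2
      _ = _ := by ring
  have := Nat.le_of_mul_le_mul_right h4 h3
  omega

/-- 43 = 29 + 14: a layer overshoots its nominal size by at most one column, which has at most 14 a
l entries in the group. -/
theorem card_layer_le {p : Fin n → Fin a} {A : Matrix (Fin n) (Fin n) R} {P : Fin a} (ha : 0 < a)
    (hl : 0 < l) (h : #{i | p i = P} ≤ 14 * (a * l)) (r : ℕ) :
    #{e : Fin n × Fin n | p e.1 = P ∧ layer l p A P e.2 = r ∧ A e.1 e.2 ≠ 0} ≤
      43 * (a ^ 2 * l ^ 2) := by
  have h1 := sum_prefixSum_div_eq_le (groupCount p A P)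
    (fun k => (groupCount_le p A P k).trans h) (D := 29 * (a ^ 2 * l ^ 2)) (by positivity) r
  rw [sum_groupCount] at h1
  have h2 : a * l ≤ a ^ 2 * l ^ 2 := by
    rw [← mul_pow]
    exact Nat.le_self_pow two_ne_zero _
  simp only [mem_filter, mem_univ, true_and] at h1
  change #{e : Fin n × Fin n | p e.1 = P ∧ layer l p A P e.2 = r ∧ A e.1 e.2 ≠ 0} ≤ _ at h1
  omega

end Partition

/-! ### Learning the layers and storing the entries -/

section Stages

open Finset
open scoped Classical

variable {n b a l : ℕ} {X R : Type*} [Zero R] {β : Type u} [Nonempty β] {V : Set X}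
  {K : Fin n → Setoid X} {out : X → Fin n → β} {B : X → ℕ}

/-- Three rounds after which every node knows the layers of all groups of rows of `A x`. -/
theorem Solves.learnLayers (hb : n + 1 ≤ 2 ^ b) (ha : 0 < a) (hal : a * l ≤ n)
    (p : Fin n → Fin a) (A : X → Matrix (Fin n) (Fin n) R)
    (hA : Determines V K (fun x v => A x v))
    (hl : ∀ x ∈ V, ∀ P k, layer l p (A x) P k < l)
    (h : ∀ K' : Fin n → Setoid X, (∀ v, K' v ≤ K v) →
      Determines V K' (fun x _ => layer l p (A x)) → Solves b V K' out B) :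
    Solves b V K out (fun x => B x + 3) := by
  rcases Nat.eq_zero_or_pos n with rfl | hn
  · exact (h K (fun v => le_rfl) (fun v => v.elim0)).mono_bound (fun x _ => by omega)
  have hM : Fintype.card (Fin (n + 1)) ≤ 2 ^ b := by simpa using hb
  have hcard : ∀ F : Finset (Fin n), #F < n + 1 := fun F => by
    simpa [Nat.lt_succ_iff] using card_le_univ F
  -- Node P + a r serves group P and announces the r-th jump of its layer function; a l ≤ n provides
  -- a node for every pair.
  let grp : Fin n → Fin a := fun u => ⟨u % a, Nat.mod_lt _ ha⟩
  -- Node `k` learns the pattern of column `k`, then sends each server the count for its group; the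
  -- server now knows the layers of the group.
  refine Solves.exchange (M := Bool) (by simp; omega) (fun x v k => decide (A x v k ≠ 0))
    (fun v x hx x' hx' hK => by simp only [hA v x hx x' hx' hK]) (fun K₁ hK₁ hd₁ => ?_)
  refine Solves.exchange hM (fun x k u => ⟨groupCount p (A x) (grp u) k, hcard _⟩)
    (fun k x hx x' hx' hK => ?_) (fun K₂ hK₂ hd₂ => ?_)
  · have e : ∀ v, (A x v k ≠ 0) ↔ (A x' v k ≠ 0) := fun v => by
      exact decide_eq_decide.1 (congrFun (hd₁ k x hx x' hx' hK) v)
    simp only [groupCount, e]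
  refine Solves.exchange hM (fun x u _ => ⟨#{k | layer l p (A x) (grp u) k ≤ u / a}, hcard _⟩)
    (fun u x hx x' hx' hK => ?_)
    (fun K₃ hK₃ hd₃ => h K₃ (fun v => (hK₃ v).trans ((hK₂ v).trans (hK₁ v))) ?_)
  · have e : groupCount p (A x) (grp u) = groupCount p (A x') (grp u) := funext fun k =>
      Fin.mk.inj (congrFun (hd₂ u x hx x' hx' hK) k)
    funext _
    have e' : layer l p (A x) (grp u) = layer l p (A x') (grp u) := by
      unfold layer
      rw [e]
    refine Fin.ext ?_
    simp only [e']
  · intro v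
    have half : ∀ x ∈ V, ∀ x' ∈ V, K₃ v x x' → ∀ P k,
        layer l p (A x) P k ≤ layer l p (A x') P k := by
      intro x hx x' hx' hK P k
      have hr := hl x' hx' P k
      have hu : (P : ℕ) + a * layer l p (A x') P k < n := by
        have := P.2
        nlinarith
      have e := congrFun (hd₃ v x hx x' hx' hK) ⟨_, hu⟩
      have e1 : grp ⟨_, hu⟩ = P := by
        apply Fin.ext
        simp [grp, Nat.mod_eq_of_lt P.2]
      have e2 : ((P : ℕ) + a * layer l p (A x') P k) / a = layer l p (A x') P k := by
        rw [Nat.add_mul_div_left _ _ ha, Nat.div_eq_of_lt P.2, zero_add]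
      simp only [e1, e2, Fin.mk.injEq] at e
      rw [← lt_card_filter_le_iff (layer_mono p (A x) P), e,
        lt_card_filter_le_iff (layer_mono p (A x') P)]
    intro x hx x' hx' hK
    funext P k
    exact le_antisymm (half x hx x' hx' hK P k) (half x' hx' x hx ((K₃ v).symm hK) P k)

/-- The non-zero entries of `A x`, whose columns are divided into layers by `h` in a way that depends
on the group of the row, can be distributed in such a way that every node gets at most `t` of the
entries of each layer of each group. -/
theorem Solves.storeEntries {w Lg t : ℕ} (hb : n + 1 ≤ 2 ^ b) (hn : 0 < n) (dec : Word w → R)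
    (hM : Fintype.card (Option ((Fin n × Fin n) × Word w)) ≤ 2 ^ b)
    (p : Fin n → Fin a) (h : Fin a → Fin n → ℕ) (hl : ∀ P k, h P k < l)
    (A : X → Matrix (Fin n) (Fin n) R) (hdec : ∀ x ∈ V, ∀ i j, A x i j ∈ Set.range dec)
    (hA : Determines V K (fun x v => A x v)) (hLg : 2 * Lg < n * t)
    (hchunk : ∀ x ∈ V, ∀ P r,
      #{e : Fin n × Fin n | p e.1 = P ∧ h P e.2 = r ∧ A x e.1 e.2 ≠ 0} ≤ Lg)
    (hout : ∀ V' ⊆ V, ∀ K' : Fin n → Setoid X, (∀ v, K' v ≤ K v) →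
      ∀ κ : X → Fin n × Fin n → Fin n,
      (∀ x ∈ V', ∀ P r u,
        #{e : Fin n × Fin n | p e.1 = P ∧ h P e.2 = r ∧ A x e.1 e.2 ≠ 0 ∧ κ x e = u} ≤ t) →
      Determines V' K' (fun x u (e : Fin n × Fin n) => if κ x e = u then A x e.1 e.2 else 0) →
      Solves b V' K' out B) :
    Solves b V K out (fun x => B x + 3 + l) := by
  have hcard : ∀ F : Finset (Fin n), #F < n + 1 := fun F => by
    simpa [Nat.lt_succ_iff] using card_le_univ F
  let cnt : Fin n → (Fin n → R) → ℕ → ℕ := fun v ρ r => #{k | ρ k ≠ 0 ∧ h (p v) k = r}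
  refine Solves.rounds (M := Fin (n + 1)) (by simpa using hb) l
    (fun r x v _ => ⟨cnt v (A x v) r, hcard _⟩)
    (fun r _ v x hx x' hx' hK => by simp only [hA v x hx x' hx' hK]) (fun K₁ hK₁ hd₁ => ?_)
  refine Solves.of_fibers (fun x v => cnt v (A x v)) (fun u x hx x' hx' hK => ?_)
    (fun x₀ hx₀ => ?_)
  · funext v r
    rcases lt_or_ge r l with hr | hr
    · simpa using congrFun (hd₁ r hr u x hx x' hx' hK) v
    · have : ∀ ρ, cnt v ρ r = 0 := fun ρ => by
        simp only [cnt, card_eq_zero, filter_eq_empty_iff, mem_univ, true_implies, not_and]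
        intro k _
        have := hl (p v) k
        omega
      simp only [this]
  set V' : Set X := {x ∈ V | (fun v => cnt v (A x v)) = fun v => cnt v (A x₀ v)}
  have hV' : V' ⊆ V := fun x hx => hx.1
  -- A row has at most n entries and 2 n < 3 n, so each colour occurs at most three times in it:
  -- three rounds suffice for storing.
  obtain ⟨col, hcol, hcol'⟩ := exists_balanced_coloring (n := n) (tf := 3) (Lf := n) (by omega) hLg
    (f := fun e : Fin n × Fin n => e.1) (g := fun e => (p e.1, h (p e.1) e.2))
    (univ.filter fun e => A x₀ e.1 e.2 ≠ 0)
    (fun i => by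
      calc _ ≤ #(univ.image fun k : Fin n => (i, k)) := card_le_card fun e he => by
            rw [mem_filter] at he
            exact mem_image.2 ⟨e.2, mem_univ _, by rw [← he.2]⟩
        _ ≤ n := card_image_le.trans (by simp))
    (fun ⟨P, r⟩ => by
      refine le_trans (card_le_card fun e he => ?_) (hchunk x₀ hx₀ P r)
      simp only [mem_filter, mem_univ, true_and, Prod.mk.injEq] at he ⊢
      obtain ⟨h1, rfl, h2⟩ := he
      exact ⟨rfl, h2, h1⟩)
  -- The injection from the actual row `ρ` into the reference row depends on `v` and `ρ` only, so
  -- the owner of the row can compute the resulting colours.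
  have hσ : ∀ v (ρ : Fin n → R), ∃ σ : Fin n → Fin n, cnt v ρ = cnt v (A x₀ v) →
      Set.InjOn σ {k | ρ k ≠ 0} ∧
        ∀ k, ρ k ≠ 0 → A x₀ v (σ k) ≠ 0 ∧ h (p v) (σ k) = h (p v) k := by
    intro v ρ
    by_cases hc : cnt v ρ = cnt v (A x₀ v)
    · obtain ⟨σ, h1, h2⟩ := exists_injOn_of_card_fiber_eq (h (p v))
        (univ.filter fun k => ρ k ≠ 0) (univ.filter fun k => A x₀ v k ≠ 0)
        (fun r => by simpa only [filter_filter] using congrFun hc r)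
      exact ⟨σ, fun _ => ⟨by simpa using h1, by simpa using h2⟩⟩
    · exact ⟨id, fun h0 => (hc h0).elim⟩
  choose σ hσ using hσ
  let κ : X → Fin n × Fin n → Fin n := fun x e => col (e.1, σ e.1 (A x e.1) e.2)
  have hσ' : ∀ x ∈ V', ∀ i, Set.InjOn (σ i (A x i)) {k | A x i k ≠ 0} ∧ ∀ k, A x i k ≠ 0 →
      A x₀ i (σ i (A x i) k) ≠ 0 ∧ h (p i) (σ i (A x i) k) = h (p i) k :=
    fun x hx i => hσ i (A x i) (congrFun hx.2 i)
  have hinj : ∀ x ∈ V', Set.InjOn (fun e : Fin n × Fin n => (e.1, σ e.1 (A x e.1) e.2))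
      {e | A x e.1 e.2 ≠ 0} := by
    rintro x hx ⟨i, k⟩ hk ⟨i', k'⟩ hk' he
    obtain ⟨rfl, h2⟩ := Prod.mk.inj he
    exact Prod.ext rfl ((hσ' x hx i).1 hk hk' h2)
  refine Solves.sendEntries (ι := Fin n × Fin n) dec hM 3 (fun x e => A x e.1 e.2)
    (fun x hx e => hdec x (hV' hx) _ _) (fun x v e => e.1 = v) (fun x u e => κ x e = u)
    (fun x _ u e _ => ⟨e.1, rfl⟩) (fun v x hx x' hx' hK => ?_) (fun x hx v u => ?_)
    (fun K' hK' hd => hout V' hV' K' (fun v => (hK' v).trans (hK₁ v)) κ (fun x hx P r u => ?_)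
      (by convert hd))
  · have e : A x v = A x' v := hA v x (hV' hx) x' (hV' hx') (hK₁ v hK)
    funext u ⟨i, k⟩
    by_cases hi : i = v
    · subst hi
      simp only [κ, e]
    · simp [hi]
  · refine le_trans (card_le_card_of_injOn _ ?_ ((hinj x hx).mono ?_)) (hcol v u)
    · rintro ⟨i, k⟩ he
      simp only [coe_filter, mem_univ, true_and, Set.mem_ofPred_eq] at he ⊢
      refine ⟨mem_filter.2 ⟨mem_univ _, ?_⟩, he.1, he.2.1⟩
      exact ((hσ' x hx i).2 k he.2.2).1
    · intro e he
      simp only [coe_filter, mem_univ, true_and, Set.mem_ofPred_eq] at he ⊢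
      exact he.2.2
  · refine le_trans (card_le_card_of_injOn _ ?_ ((hinj x hx).mono ?_)) (hcol' (P, r) u)
    · rintro ⟨i, k⟩ he
      simp only [coe_filter, mem_univ, true_and, Set.mem_ofPred_eq] at he ⊢
      obtain ⟨rfl, h1, h2, h3⟩ := he
      refine ⟨mem_filter.2 ⟨mem_univ _, ((hσ' x hx i).2 k h2).1⟩,
        by rw [((hσ' x hx i).2 k h2).2, h1], h3⟩
    · intro e he
      simp only [coe_filter, mem_univ, true_and, Set.mem_ofPred_eq] at he ⊢
      exact he.2.2.1

end Stages

/-! ### Multiplication with known counts -/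

section Multiplication

open Finset
open scoped Classical

/-- The cube accommodates the largest index set in use, `Fin n × Fin n × Fin l` with l ≤ n;
strictness pays for `none`. -/
theorem card_option_prod_word_le {ι : Type*} [Fintype ι] {n w b : ℕ} (hb : n ^ 3 * 2 ^ w < 2 ^ b)
    (hι : Fintype.card ι ≤ n ^ 3) : Fintype.card (Option (ι × Word w)) ≤ 2 ^ b := by
  simp only [Fintype.card_option, Fintype.card_prod, Word, Fintype.card_fun, Fintype.card_bool,
    Fintype.card_fin]
  have := Nat.mul_le_mul_right (2 ^ w) hι
  omega

/-- When the numbers of non-zero entries of the rows of `S` and the columns of `T` are known, the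
product is computed in `O(l)` rounds, where `a² l` is about `n` and `S` and `T` have `O(a³ l³)`
non-zero entries. -/
theorem solves_mul_of_counts {n b w a l : ℕ} {R : Type u} [Semiring R] {X : Type*} {V : Set X}
    {K : Fin n → Setoid X} (hn : 0 < n) (hb : n ^ 3 * 2 ^ w < 2 ^ b) (dec : Word w → R)
    (S T : X → Matrix (Fin n) (Fin n) R) (hrep : ∀ x ∈ V, Representable dec (S x) (T x))
    (hS : Determines V K (fun x v => S x v)) (hT : Determines V K (fun x v => (T x).transpose v))
    (ha : 0 < a) (hl : 0 < l) (han : a ^ 2 * l ≤ n) (hna : n ≤ 2 * (a ^ 2 * l)) (s t : Fin n → ℕ)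
    (hs : ∀ x ∈ V, ∀ i, #{k | S x i k ≠ 0} = s i)
    (ht : ∀ x ∈ V, ∀ j, #{k | (T x).transpose j k ≠ 0} = t j)
    (hs' : ∑ i, s i ≤ 8 * (a ^ 3 * l ^ 3)) (ht' : ∑ i, t i ≤ 8 * (a ^ 3 * l ^ 3)) :
    Solves b V K (fun x v => (S x * T x) v)
      -- Read from the right, in order of time: layers of `S` and of `T`, storing `S` and `T`,
      -- fetching from `S` and from `T`, collecting partial sums, returning the rows.
      (fun _ => 0 + 3 + 393 * l + 87 * l + 87 * l + 3 + l + 3 + l + 3 + 3) := by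
  rcases V.eq_empty_or_nonempty with rfl | ⟨x₁, hx₁⟩
  · exact ⟨fun x v => .ret ((S x * T x) v), fun v x hx => hx.elim, fun x hx => hx.elim⟩
  have hcard : ∀ F : Finset (Fin n), #F ≤ n := fun F => by simpa using card_le_univ F
  have hb' : n + 1 ≤ 2 ^ b := by
    have h1 : n ≤ n ^ 3 := Nat.le_self_pow three_ne_zero n
    have h2 : n ^ 3 * 1 ≤ n ^ 3 * 2 ^ w := Nat.mul_le_mul_left _ Nat.one_le_two_pow
    omega
  have hal : a * l ≤ n := le_trans (Nat.mul_le_mul_right l (Nat.le_self_pow two_ne_zero a)) han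
  have hln : l ≤ n := le_trans (Nat.le_mul_of_pos_left l ha) hal
  have hn2 : n * n ≤ n ^ 3 := by
    calc n * n = n ^ 2 := (sq n).symm
      _ ≤ n ^ 3 := Nat.pow_le_pow_right hn (by norm_num)
  have hM2 : Fintype.card (Option ((Fin n × Fin n) × Word w)) ≤ 2 ^ b :=
    card_option_prod_word_le hb (by simpa using hn2)
  have hM3 : Fintype.card (Option ((Fin n × Fin n × Fin l) × Word w)) ≤ 2 ^ b :=
    card_option_prod_word_le hb (by
      simp only [Fintype.card_prod, Fintype.card_fin]
      calc n * (n * l) ≤ n * (n * n) := by gcongr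
        _ = n ^ 3 := by ring)
  obtain ⟨p, hp, hps⟩ := exists_grouping ha hl hna s
    (fun i => (hs x₁ hx₁ i).symm.trans_le (hcard _)) hs'
  obtain ⟨q, hq, hqt⟩ := exists_grouping ha hl hna t
    (fun i => (ht x₁ hx₁ i).symm.trans_le (hcard _)) ht'
  have hpl : ∀ x ∈ V, ∀ P k, 2 * layer l p (S x) P k < l := fun x hx P k =>
    two_mul_layer_lt ha hl (by simpa only [hs x hx] using hps P) k
  have hql : ∀ x ∈ V, ∀ Q k, 2 * layer l q (T x).transpose Q k < l := fun x hx Q k =>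
    two_mul_layer_lt ha hl (by simpa only [ht x hx] using hqt Q) k
  refine Solves.learnLayers hb' ha hal p S hS (fun x hx P k => by have := hpl x hx P k; omega)
    (fun K₁ hK₁ hd₁ => ?_)
  refine Solves.learnLayers hb' ha hal q (fun x => (T x).transpose) (hT.mono subset_rfl hK₁)
    (fun x hx P k => by have := hql x hx P k; omega) (fun K₂ hK₂ hd₂ => ?_)
  refine Solves.of_fibers (fun x => (layer l p (S x), layer l q (T x).transpose))
    (fun v x hx x' hx' hK => Prod.ext (hd₁ v x hx x' hx' (hK₂ v hK)) (hd₂ v x hx x' hx' hK))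
    (fun x₀ hx₀ => ?_)
  set f := layer l p (S x₀) with hf
  set g := layer l q (T x₀).transpose with hg
  have hflt := hpl x₀ hx₀
  have hglt := hql x₀ hx₀
  have hfmono : ∀ P, Monotone (f P) := layer_mono p _
  have hgmono : ∀ Q, Monotone (g Q) := layer_mono q _
  rw [← hf] at hflt
  rw [← hg] at hglt
  set V₀ : Set X := {x ∈ V | (layer l p (S x), layer l q (T x).transpose) = (f, g)}
  have hV₀ : V₀ ⊆ V := fun x hx => hx.1
  have hV₀f : ∀ x ∈ V₀, layer l p (S x) = f := fun x hx => congrArg Prod.fst hx.2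
  have hV₀g : ∀ x ∈ V₀, layer l q (T x).transpose = g := fun x hx => congrArg Prod.snd hx.2
  have hpos : 0 < n * l := Nat.mul_pos hn hl
  have hsq : a ^ 2 * l ^ 2 ≤ n * l := by
    calc a ^ 2 * l ^ 2 = a ^ 2 * l * l := by ring
      _ ≤ n * l := Nat.mul_le_mul_right l han
  -- A layer has at most 43 n l entries, and 2 · 43 < 87.
  have hLt : 2 * (43 * (a ^ 2 * l ^ 2)) < n * (87 * l) := by
    have : n * (87 * l) = 87 * (n * l) := by ring
    omega
  refine Solves.storeEntries hb' hn dec hM2 p f (fun P k => by have := hflt P k; omega) S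
    (fun x hx => (hrep x (hV₀ hx)).1) (hS.mono hV₀ (fun v => (hK₂ v).trans (hK₁ v))) hLt
    (fun x hx P r => by rw [← hV₀f x hx]; exact card_layer_le ha hl (hp P) r)
    (fun V₁ hV₁ K₃ hK₃ κ hκ hdκ => ?_)
  refine Solves.storeEntries hb' hn dec hM2 q g (fun P k => by have := hglt P k; omega)
    (fun x => (T x).transpose)
    (fun x hx i j => (hrep x (hV₀ (hV₁ hx))).2.1 j i)
    (hT.mono (hV₁.trans hV₀) (fun v => (hK₃ v).trans ((hK₂ v).trans (hK₁ v)))) hLt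
    (fun x hx P r => by rw [← hV₀g x (hV₁ hx)]; exact card_layer_le ha hl (hq P) r)
    (fun V₂ hV₂ K₄ hK₄ μ hμ hdμ => ?_)
  have hV₂V : V₂ ⊆ V := hV₂.trans (hV₁.trans hV₀)
  -- Mixed radix: y = P + a (Q + a ρ). Nodes with ρ ≥ l want nothing, as f + g < l.
  let P : Fin n → Fin a := fun y => ⟨y % a, Nat.mod_lt _ ha⟩
  let Q : Fin n → Fin a := fun y => ⟨y / a % a, Nat.mod_lt _ ha⟩
  let ρ : Fin n → ℕ := fun y => y / a / a
  have hsurj : ∀ (P₀ Q₀ : Fin a) (r : Fin l), ∃ y, P y = P₀ ∧ Q y = Q₀ ∧ ρ y = r := by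
    intro P₀ Q₀ r
    have h1 : (P₀ : ℕ) + a * (Q₀ + a * r) < n := by
      refine lt_of_lt_of_le ?_ han
      have h2 : (Q₀ : ℕ) + a * r + 1 ≤ a * l := by nlinarith [Q₀.2, r.2]
      nlinarith [P₀.2, Nat.mul_le_mul_left a h2]
    have h2 : ((P₀ : ℕ) + a * (Q₀ + a * r)) / a = Q₀ + a * r := by
      rw [Nat.add_mul_div_left _ _ ha, Nat.div_eq_of_lt P₀.2, zero_add]
    refine ⟨⟨_, h1⟩, Fin.ext ?_, Fin.ext ?_, ?_⟩
    · simp [P, Nat.mod_eq_of_lt P₀.2]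
    · simp only [Q, h2]
      simp [Nat.mod_eq_of_lt Q₀.2]
    · simp only [ρ, h2]
      rw [Nat.add_mul_div_left _ _ ha, Nat.div_eq_of_lt Q₀.2, zero_add]
  -- The columns of one sum of layers belong to a single layer of each of the two matrices.
  have hlevel : ∀ (P₀ Q₀ : Fin a) (r : ℕ), ∃ r₁ r₂, ∀ k, f P₀ k + g Q₀ k = r →
      f P₀ k = r₁ ∧ g Q₀ k = r₂ := by
    intro P₀ Q₀ r
    by_cases h : ∃ k, f P₀ k + g Q₀ k = r
    · obtain ⟨k₀, hk₀⟩ := h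
      refine ⟨f P₀ k₀, g Q₀ k₀, fun k hk => ?_⟩
      -- Both summands move in the same direction, so equal sums force both to be equal.
      rcases le_total k k₀ with h | h
      all_goals
        have h1 := hfmono P₀ h
        have h2 := hgmono Q₀ h
        omega
    · exact ⟨0, 0, fun k hk => (h ⟨k, hk⟩).elim⟩
  refine Solves.sendEntries (ι := Fin n × Fin n) dec hM2 (87 * l) (fun x e => S x e.1 e.2)
    (fun x hx e => (hrep x (hV₂V hx)).1 _ _) (fun x v e => κ x e = v)
    (fun x y e => p e.1 = P y ∧ f (P y) e.2 + g (Q y) e.2 = ρ y) (fun x _ _ e _ => ⟨κ x e, rfl⟩)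
    (fun v x hx x' hx' hK => ?_) (fun x hx v y => ?_) (fun K₅ hK₅ hd₅ => ?_)
  · have e₀ := hdκ v x (hV₂ hx) x' (hV₂ hx') (hK₄ v hK)
    funext y e
    by_cases hc : p e.1 = P y ∧ f (P y) e.2 + g (Q y) e.2 = ρ y
    · simpa [hc] using congrFun e₀ e
    · simp only [hc, and_false, if_false]
  -- All that `y` wants lies in one layer of its group, of which any node stores at most 87 l
  -- entries.
  · obtain ⟨r₁, r₂, hr⟩ := hlevel (P y) (Q y) (ρ y)
    refine le_trans (card_le_card fun e he => ?_) (hκ x (hV₂ hx) (P y) r₁ v)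
    simp only [mem_filter, mem_univ, true_and] at he ⊢
    exact ⟨he.2.1.1, (hr _ he.2.1.2).1, he.2.2, he.1⟩
  refine Solves.sendEntries (ι := Fin n × Fin n) dec hM2 (87 * l)
    (fun x e => (T x).transpose e.1 e.2)
    (fun x hx e => (hrep x (hV₂V hx)).2.1 _ _) (fun x v e => μ x e = v)
    (fun x y e => q e.1 = Q y ∧ f (P y) e.2 + g (Q y) e.2 = ρ y) (fun x _ _ e _ => ⟨μ x e, rfl⟩)
    (fun v x hx x' hx' hK => ?_) (fun x hx v y => ?_) (fun K₆ hK₆ hd₆ => ?_)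
  · have e₀ := hdμ v x hx x' hx' (hK₅ v hK)
    funext y e
    by_cases hc : q e.1 = Q y ∧ f (P y) e.2 + g (Q y) e.2 = ρ y
    · simpa [hc] using congrFun e₀ e
    · simp only [hc, and_false, if_false]
  · obtain ⟨r₁, r₂, hr⟩ := hlevel (P y) (Q y) (ρ y)
    refine le_trans (card_le_card fun e he => ?_) (hμ x hx (Q y) r₂ v)
    simp only [mem_filter, mem_univ, true_and] at he ⊢
    exact ⟨he.2.1.1, (hr _ he.2.1.2).2, he.2.2, he.1⟩
  -- Colours name the nodes that add up the partial sums of a position. All positions are coloured,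
  -- since the support of the product is unknown; a pair of groups has at most 196 n l of them, and
  -- 2 · 196 < 393.
  obtain ⟨col, hcol, hcol'⟩ := exists_balanced_coloring (n := n) (tf := 3) (Lf := n)
    (Lg := 196 * (n * l)) (tg := 393 * l) (by omega) (by nlinarith)
    (f := fun e : Fin n × Fin n => e.1) (g := fun e => (p e.1, q e.2)) univ
    (fun i => by
      calc _ ≤ #(univ.image fun k : Fin n => (i, k)) := card_le_card fun e he => by
            rw [mem_filter] at he
            exact mem_image.2 ⟨e.2, mem_univ _, by rw [← he.2]⟩
        _ ≤ n := card_image_le.trans (by simp))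
    (fun ⟨P₀, Q₀⟩ => by
      calc _ ≤ #((univ.filter fun i => p i = P₀) ×ˢ (univ.filter fun j => q j = Q₀)) :=
            card_le_card fun e he => by
              simpa [mem_product] using he
        _ ≤ (14 * (a * l)) * (14 * (a * l)) := by
            rw [card_product]
            exact Nat.mul_le_mul (hp P₀) (hq Q₀)
        _ = 196 * (a ^ 2 * l ^ 2) := by ring
        _ ≤ _ := Nat.mul_le_mul_left _ hsq)
  let part : X → Fin n × Fin n × Fin l → R := fun x e =>
    ∑ k with f (p e.1) k + g (q e.2.1) k = e.2.2, S x e.1 k * T x k e.2.1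
  refine Solves.sendEntries (ι := Fin n × Fin n × Fin l) dec hM3 (393 * l) part
    (fun x hx e => (hrep x (hV₂V hx)).2.2 _ _ _)
    (fun x y e => p e.1 = P y ∧ q e.2.1 = Q y ∧ (e.2.2 : ℕ) = ρ y)
    (fun x u e => col (e.1, e.2.1) = u)
    (fun x _ _ e _ => (hsurj (p e.1) (q e.2.1) e.2.2).imp fun y hy =>
      ⟨hy.1.symm, hy.2.1.symm, hy.2.2.symm⟩)
    (fun y x hx x' hx' hK => ?_) (fun x hx y u => ?_) (fun K₇ hK₇ hd₇ => ?_)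
  · have e₁ := hd₅ y x hx x' hx' (hK₆ y hK)
    have e₂ := hd₆ y x hx x' hx' hK
    funext u e
    by_cases hc : p e.1 = P y ∧ q e.2.1 = Q y ∧ (e.2.2 : ℕ) = ρ y
    · have : part x e = part x' e := by
        refine sum_congr rfl fun k hk => ?_
        have hk' := (mem_filter.1 hk).2
        rw [hc.1, hc.2.1, hc.2.2] at hk'
        have h1 := congrFun e₁ (e.1, k)
        have h2 := congrFun e₂ (e.2.1, k)
        simp only [hc.1, hc.2.1, hk', and_self, if_true, Matrix.transpose_apply] at h1 h2
        rw [h1, h2]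
      dsimp only
      rw [this]
    · simp only [hc, false_and, if_false]
  · refine le_trans (card_le_card_of_injOn (fun e => (e.1, e.2.1)) ?_ ?_) (hcol' (P y, Q y) u)
    · intro e he
      simp only [coe_filter, mem_univ, true_and, Set.mem_ofPred_eq] at he ⊢
      exact ⟨Prod.ext he.1.1 he.1.2.1, he.2.1⟩
    · rintro ⟨i, j, r⟩ he ⟨i', j', r'⟩ he' hee
      simp only [coe_filter, mem_univ, true_and, Set.mem_ofPred_eq] at he he'
      obtain ⟨rfl, rfl⟩ := Prod.mk.inj hee
      rw [Fin.ext (he.1.2.2.trans he'.1.2.2.symm)]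
  have hpart : ∀ x i j, (S x * T x) i j = ∑ r : Fin l, part x (i, j, r) := by
    intro x i j
    rw [Matrix.mul_apply]
    simp only [part]
    let lev : Fin n → Fin l := fun k => ⟨f (p i) k + g (q j) k, by
      have h1 := hflt (p i) k
      have h2 := hglt (q j) k
      omega⟩
    rw [← sum_fiberwise univ lev]
    refine sum_congr rfl fun r _ => sum_congr (filter_congr fun k _ => ?_) fun _ _ => rfl
    exact Fin.ext_iff
  refine Solves.sendEntries (ι := Fin n × Fin n) dec hM2 3 (fun x e => (S x * T x) e.1 e.2)
    (fun x hx e => by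
      rw [Matrix.mul_apply]
      exact (hrep x (hV₂V hx)).2.2 e.1 e.2 univ)
    (fun x u e => col e = u) (fun x v e => e.1 = v) (fun x _ _ e _ => ⟨col e, rfl⟩)
    (fun u x hx x' hx' hK => ?_) (fun x hx u v => ?_)
    (fun K₈ hK₈ hd₈ => Solves.of_determines fun v x hx x' hx' hK => ?_)
  · have e₀ := hd₇ u x hx x' hx' hK
    funext v e
    by_cases hc : col e = u
    · have : (S x * T x) e.1 e.2 = (S x' * T x') e.1 e.2 := by
        rw [hpart, hpart]
        refine sum_congr rfl fun r _ => ?_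
        simpa [hc] using congrFun e₀ (e.1, e.2, r)
      dsimp only
      rw [this]
    · simp only [hc, false_and, if_false]
  · refine le_trans (card_le_card fun e he => ?_) (hcol v u)
    simp only [mem_filter, mem_univ, true_and] at he ⊢
    exact ⟨he.2.1, he.1⟩
  · have e₀ := hd₈ v x hx x' hx' hK
    funext j
    simpa using congrFun e₀ (v, j)

end Multiplication

/-! ### Choice of parameters and unknown sparsity -/

section Rounds

open Finset
open scoped Classical

theorem nz_eq_sum {n : ℕ} {R : Type u} [Zero R] (A : Matrix (Fin n) (Fin n) R) :
    nz A = ∑ i, #{k | A i k ≠ 0} := by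
  unfold nz
  rw [Set.ncard_eq_toFinset_card', card_eq_sum_card_fiberwise (f := Prod.fst) (t := univ)
    (fun _ _ => mem_univ _)]
  refine sum_congr rfl fun i _ => ?_
  refine (card_bij (fun k _ => (i, k)) ?_ ?_ ?_).symm
  · intro k hk
    simpa using hk
  · intro k _ k' _ h
    exact congrArg Prod.snd h
  · rintro ⟨i', k⟩ h
    simp only [mem_filter, Set.mem_toFinset, Set.mem_ofPred_eq] at h
    obtain ⟨h, rfl⟩ := h
    exact ⟨k, by simpa using h, rfl⟩

theorem nz_transpose {n : ℕ} {R : Type u} [Zero R] (A : Matrix (Fin n) (Fin n) R) :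
    nz A.transpose = nz A := by
  rw [nz_eq_sum, nz_eq_sum]
  simp only [card_filter]
  exact sum_comm

theorem nz_le_sq {n : ℕ} {R : Type u} [Zero R] (A : Matrix (Fin n) (Fin n) R) : nz A ≤ n ^ 2 := by
  rw [nz_eq_sum]
  calc ∑ i, #{k | A i k ≠ 0} ≤ ∑ _i : Fin n, n := sum_le_sum fun i _ => by
        simpa using card_le_univ (univ.filter fun k => A i k ≠ 0)
    _ = n ^ 2 := by simp [sq]

/-- The numbers `a` of groups and `l` of layers with which matrices with `N` non-zero entries are
multiplied. -/
theorem exists_parameters {n N : ℕ} (hn : 0 < n) (hN : N ≤ n ^ 2) : ∃ a l : ℕ, 0 < a ∧ 0 < l ∧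
    a ^ 2 * l ≤ n ∧ n ≤ 2 * (a ^ 2 * l) ∧ N ≤ 8 * (a ^ 3 * l ^ 3) ∧
    (l : ℝ) ≤ 4 * ((N : ℝ) ^ ((2 : ℝ) / 3) / n + 1) := by
  -- The largest such `a` is used with l = n / a². The second condition yields N ≤ 8 a³ l³, and the
  -- failure at a + 1 bounds `l`.
  let p : ℕ → Prop := fun a => a ^ 2 ≤ n ∧ a ^ 3 * N ≤ n ^ 3
  have hp1 : p 1 := by
    refine ⟨by omega, ?_⟩
    calc 1 ^ 3 * N = N := by ring
      _ ≤ n ^ 2 := hN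
      _ ≤ n ^ 3 := Nat.pow_le_pow_right hn (by norm_num)
  set a := Nat.findGreatest p n with ha'
  have hpa : p a := Nat.findGreatest_spec (P := p) hn hp1
  have ha : 0 < a := Nat.le_findGreatest hn hp1
  have hnot : ¬ p (a + 1) := by
    rcases le_or_gt (a + 1) n with h | h
    · exact Nat.findGreatest_is_greatest (P := p) (Nat.lt_succ_self a) h
    · intro h'
      have := h'.1
      nlinarith
  obtain ⟨ha2, ha3⟩ := hpa
  have hapos : 0 < a ^ 2 := by positivity
  have hl : 0 < n / a ^ 2 := Nat.div_pos ha2 hapos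
  have hle : a ^ 2 * (n / a ^ 2) ≤ n := Nat.mul_div_le _ _
  have hlt : n < a ^ 2 * (n / a ^ 2 + 1) := Nat.lt_mul_div_succ _ hapos
  set l := n / a ^ 2
  have hn2 : n ≤ 2 * (a ^ 2 * l) := by nlinarith
  refine ⟨a, l, ha, hl, hle, hn2, ?_, ?_⟩
  · refine le_of_mul_le_mul_left (a := a ^ 3) ?_ (by positivity)
    calc a ^ 3 * N ≤ n ^ 3 := ha3
      _ ≤ (2 * (a ^ 2 * l)) ^ 3 := Nat.pow_le_pow_left hn2 3
      _ = a ^ 3 * (8 * (a ^ 3 * l ^ 3)) := by ring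
  · have hy : (0 : ℝ) ≤ (N : ℝ) ^ ((2 : ℝ) / 3) := by positivity
    have hnR : (0 : ℝ) < n := by exact_mod_cast hn
    have hdiv : 0 ≤ (N : ℝ) ^ ((2 : ℝ) / 3) / n := by positivity
    simp only [p, not_and_or, not_le] at hnot
    -- Either (a + 1)² > n, and then l < 4, or (a + 1)³ N > n³, and then (n l)³ ≤ 64 N².
    rcases hnot with h | h
    · have h1 : l < 4 := by
        have : (a + 1) ^ 2 ≤ a ^ 2 * 4 := by nlinarith
        exact Nat.lt_of_mul_lt_mul_left (hle.trans_lt (h.trans_le this))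
      have : (l : ℝ) ≤ 4 := by exact_mod_cast h1.le
      linarith
    · have h1 : n ^ 3 < 8 * a ^ 3 * N := by
        refine h.trans_le (Nat.mul_le_mul_right N ?_)
        calc (a + 1) ^ 3 ≤ (2 * a) ^ 3 := Nat.pow_le_pow_left (by omega) 3
          _ = 8 * a ^ 3 := by ring
      have h2 : (n * l) ^ 3 * a ^ 6 ≤ (64 * N ^ 2) * a ^ 6 := by
        calc (n * l) ^ 3 * a ^ 6 = n ^ 3 * (a ^ 2 * l) ^ 3 := by ring
          _ ≤ n ^ 3 * n ^ 3 := Nat.mul_le_mul_left _ (Nat.pow_le_pow_left hle 3)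
          _ ≤ (8 * a ^ 3 * N) * (8 * a ^ 3 * N) := Nat.mul_le_mul h1.le h1.le
          _ = _ := by ring
      have h3 : (n * l) ^ 3 ≤ 64 * N ^ 2 := Nat.le_of_mul_le_mul_right h2 (by positivity)
      have h4 : ((N : ℝ) ^ ((2 : ℝ) / 3)) ^ 3 = (N : ℝ) ^ 2 := by
        rw [← Real.rpow_natCast, ← Real.rpow_mul (Nat.cast_nonneg N), ← Real.rpow_natCast]
        norm_num
      have h5 : ((n : ℝ) * l) ^ 3 ≤ (4 * (N : ℝ) ^ ((2 : ℝ) / 3)) ^ 3 := by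
        rw [mul_pow 4, h4]
        have : ((n : ℝ) * l) ^ 3 ≤ 64 * (N : ℝ) ^ 2 := by exact_mod_cast h3
        linarith
      have h6 := le_of_pow_le_pow_left₀ three_ne_zero (by positivity) h5
      have h7 : (l : ℝ) ≤ 4 * ((N : ℝ) ^ ((2 : ℝ) / 3) / n) := by
        rw [← mul_div_assoc, le_div_iff₀ hnR]
        linarith
      linarith

/-- The multiplication algorithm for matrices of unknown sparsity. -/
theorem exists_algorithm {n b w : ℕ} {R : Type u} [Semiring R] (hn : 0 < n)
    (hb : n ^ 3 * 2 ^ w < 2 ^ b) (dec : Word w → R) :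
    ∃ A : MatMulAlgorithm n b R, ∀ S T : Matrix (Fin n) (Fin n) R, Representable dec S T →
      ∃ r : ℕ, (r : ℝ) ≤ 2400 * (((max (nz S) (nz T) : ℕ) : ℝ) ^ ((2 : ℝ) / 3) / n + 1) ∧
        MultipliesWithin A S T r := by
  let X := Matrix (Fin n) (Fin n) R × Matrix (Fin n) (Fin n) R
  let V : Set X := {x | Representable dec x.1 x.2}
  let K : Fin n → Setoid X := fun v => Setoid.ker fun x => (x.1 v, x.2 v)
  have hcard : ∀ F : Finset (Fin n), #F < n + 1 := fun F => by
    simpa [Nat.lt_succ_iff] using card_le_univ F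
  have hmax : ∀ x : X, max (nz x.1) (nz x.2) ≤ n ^ 2 := fun x => max_le (nz_le_sq _) (nz_le_sq _)
  choose a l ha hl han hna hN hlR using
    fun N : {N // N ≤ n ^ 2} => exists_parameters hn N.2
  let M : X → {N // N ≤ n ^ 2} := fun x => ⟨max (nz x.1) (nz x.2), hmax x⟩
  have hsq : n * n ≤ n ^ 3 := by
    calc n * n = n ^ 2 := (sq n).symm
      _ ≤ n ^ 3 := Nat.pow_le_pow_right hn (by norm_num)
  have hM1 : Fintype.card (Fin (n + 1)) ≤ 2 ^ b := by
    have h1 : n ≤ n ^ 3 := Nat.le_self_pow three_ne_zero n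
    have h2 : n ^ 3 * 1 ≤ n ^ 3 * 2 ^ w := Nat.mul_le_mul_left _ Nat.one_le_two_pow
    rw [Fintype.card_fin]
    omega
  have main : Solves b V K (fun x v => (x.1 * x.2) v) (fun x => 597 * l (M x) + 1 + 1 + 1) := by
    have hS : Determines V K (fun x v => x.1 v) := fun v x _ x' _ h => congrArg Prod.fst h
    have hT : Determines V K (fun x v => x.2 v) := fun v x _ x' _ h => congrArg Prod.snd h
    -- Transposing `T` takes one round: a row and a column share a single entry.
    refine Solves.sendEntries (ι := Fin n × Fin n) dec
      (card_option_prod_word_le hb (by simpa using hsq)) 1 (fun x e => x.2 e.1 e.2)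
      (fun x hx e => hx.2.1 _ _) (fun x v e => e.1 = v) (fun x u e => e.2 = u)
      (fun x _ u e _ => ⟨e.1, rfl⟩) (fun v x hx x' hx' hK => ?_) (fun x hx v u => ?_)
      (fun K₁ hK₁ hd₁ => ?_)
    · have e₀ := hT v x hx x' hx' hK
      funext u ⟨i, k⟩
      by_cases hi : i = v
      · subst hi
        simp only [e₀]
      · simp only [hi, false_and, if_false]
    · refine (card_le_card fun e he => ?_).trans (card_singleton (v, u)).le
      simp only [mem_filter, mem_univ, true_and] at he
      exact mem_singleton.2 (Prod.ext he.1 he.2.1)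
    have hS₁ : Determines V K₁ (fun x v => x.1 v) := hS.mono subset_rfl hK₁
    have hT₁ : Determines V K₁ (fun x v => x.2.transpose v) := fun v x hx x' hx' hK => by
      funext k
      simpa using congrFun (hd₁ v x hx x' hx' hK) (k, v)
    -- Once the counts of the rows of `S` and the columns of `T` are broadcast, N and hence a and l
    -- are common knowledge.
    refine Solves.exchange hM1 (fun x v _ => ⟨#{k | x.1 v k ≠ 0}, hcard _⟩)
      (fun v x hx x' hx' hK => by simp only [hS₁ v x hx x' hx' hK]) (fun K₂ hK₂ hd₂ => ?_)
    refine Solves.exchange hM1 (fun x v _ => ⟨#{k | x.2.transpose v k ≠ 0}, hcard _⟩)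
      (fun v x hx x' hx' hK => by simp only [hT₁ v x hx x' hx' (hK₂ v hK)])
      (fun K₃ hK₃ hd₃ => ?_)
    refine Solves.of_fibers
      (fun x => (fun v => #{k | x.1 v k ≠ 0}, fun v => #{k | x.2.transpose v k ≠ 0}))
      (fun v x hx x' hx' hK => Prod.ext ?_ ?_) (fun x₀ hx₀ => ?_)
    · funext u
      exact Fin.mk.inj (congrFun (hd₂ v x hx x' hx' (hK₃ v hK)) u)
    · funext u
      exact Fin.mk.inj (congrFun (hd₃ v x hx x' hx' hK) u)
    have hcounts : ∀ x ∈ {x ∈ V | (fun x : X => ((fun v => #{k | x.1 v k ≠ 0},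
        fun v => #{k | x.2.transpose v k ≠ 0}) : (Fin n → ℕ) × (Fin n → ℕ))) x =
        (fun v => #{k | x₀.1 v k ≠ 0}, fun v => #{k | x₀.2.transpose v k ≠ 0})},
        (∀ i, #{k | x.1 i k ≠ 0} = #{k | x₀.1 i k ≠ 0}) ∧
        ∀ i, #{k | x.2.transpose i k ≠ 0} = #{k | x₀.2.transpose i k ≠ 0} := fun x hx =>
      ⟨congrFun (congrArg Prod.fst hx.2), congrFun (congrArg Prod.snd hx.2)⟩
    have hmono : ∀ v, K₃ v ≤ K₁ v := fun v => (hK₃ v).trans (hK₂ v)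
    refine (solves_mul_of_counts hn hb dec (fun x : X => x.1) (fun x : X => x.2)
      (fun x hx => hx.1) (hS₁.mono (fun x hx => hx.1) hmono) (hT₁.mono (fun x hx => hx.1) hmono)
      (ha (M x₀)) (hl (M x₀)) (han (M x₀)) (hna (M x₀)) (fun i => #{k | x₀.1 i k ≠ 0})
      (fun i => #{k | x₀.2.transpose i k ≠ 0}) (fun x hx => (hcounts x hx).1)
      (fun x hx => (hcounts x hx).2) ?_ ?_).mono_bound (fun x hx => ?_)
    · rw [← nz_eq_sum]
      exact (le_max_left _ _).trans (hN (M x₀))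
    · rw [← nz_eq_sum, nz_transpose]
      exact (le_max_right _ _).trans (hN (M x₀))
    · have e : M x = M x₀ := by
        refine Subtype.ext ?_
        simp only [M]
        rw [← nz_transpose x.2, ← nz_transpose x₀.2]
        simp only [nz_eq_sum, (hcounts x hx).1, (hcounts x hx).2]
      -- The stages take 569 l + 15 rounds, at most 597 l because l ≥ 1.
      have := hl (M x₀)
      rw [e]
      omega
  obtain ⟨P, hP, hr⟩ := main
  refine ⟨NodeProgram.toAlgorithm fun v i =>
    -- Any instance compatible with the input serves, by `hP`; `.ret 0` covers inputs that belong to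
    -- no representable instance.
    if h : ∃ x ∈ V, (x.1 v, x.2 v) = i then P h.choose v else .ret 0, fun S T hST => ?_⟩
  have hx : ((S, T) : X) ∈ V := hST
  obtain ⟨r, hrB, hrun⟩ := hr _ hx
  refine ⟨r, ?_, NodeProgram.Runs.computesWithin ?_⟩
  · have h1 := hlR (M (S, T))
    -- 597 l + 3 ≤ 600 l, and the factor 4 in the bound for `l` gives 2400.
    have h2 : (r : ℝ) ≤ 600 * l (M (S, T)) := by
      have := hl (M (S, T))
      exact_mod_cast (show r ≤ 600 * l (M (S, T)) by simp only at hrB; omega)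
    change _ ≤ 4 * (((max (nz S) (nz T) : ℕ) : ℝ) ^ ((2 : ℝ) / 3) / n + 1) at h1
    linarith
  · convert hrun using 2 with v
    have h : ∃ x ∈ V, (x.1 v, x.2 v) = (S v, T v) := ⟨(S, T), hx, rfl⟩
    rw [dif_pos h]
    exact hP v _ h.choose_spec.1 _ hx h.choose_spec.2

end Rounds

/-! ### Message length and the final bounds -/

/-- Three bit lengths hold the factor n³ and a fourth makes the inequality strict; hence d = c + 4.
-/
theorem pow_three_mul_two_pow_lt (n c : ℕ) :
    n ^ 3 * 2 ^ (c * bitLength n) < 2 ^ ((c + 4) * bitLength n) := by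
  have h1 : n < 2 ^ bitLength n := Nat.lt_pow_succ_log_self one_lt_two n
  have h2 : n ^ 3 ≤ 2 ^ (3 * bitLength n) := by
    rw [mul_comm, pow_mul]
    exact Nat.pow_le_pow_left h1.le 3
  have h3 : 0 < bitLength n := Nat.succ_pos _
  calc n ^ 3 * 2 ^ (c * bitLength n) ≤ 2 ^ (3 * bitLength n) * 2 ^ (c * bitLength n) :=
        Nat.mul_le_mul_right _ h2
    _ = 2 ^ (3 * bitLength n + c * bitLength n) := (pow_add _ _ _).symm
    _ < 2 ^ ((c + 4) * bitLength n) := Nat.pow_lt_pow_right one_lt_two (by linarith)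

theorem mainTheorem7 (c : ℕ) :
    ∃ (d : ℕ) (SMM : ∀ (n : ℕ) (R : Type u) [Semiring R] (_dec : Word (c * bitLength n) → R),
        MatMulAlgorithm n (d * bitLength n) R),
      (∀ κ : ℝ, ∃ C : ℝ, ∀ (n : ℕ), 1 ≤ n → ∀ (R : Type u) [Semiring R]
          (dec : Word (c * bitLength n) → R) (S T : Matrix (Fin n) (Fin n) R),
          Representable dec S T →
          ∀ m : ℕ, (nz S : ℝ) ≤ κ * m → (nz T : ℝ) ≤ κ * m →
            ∃ r : ℕ, (r : ℝ) ≤ C * ((m : ℝ) ^ ((2 : ℝ) / 3) / n + 1) ∧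
              MultipliesWithin (SMM n R dec) S T r) ∧
      (∃ C : ℝ, ∀ (n : ℕ), 1 ≤ n → ∀ (R : Type u) [Semiring R]
          (dec : Word (c * bitLength n) → R) (S T : Matrix (Fin n) (Fin n) R),
          Representable dec S T →
            ∃ r : ℕ, (r : ℝ) ≤ C * (n : ℝ) ^ ((1 : ℝ) / 3) ∧
              MultipliesWithin (SMM n R dec) S T r) := by
  classical
  have hex : ∀ (n : ℕ) (R : Type u) [Semiring R] (dec : Word (c * bitLength n) → R),
      ∃ A : MatMulAlgorithm n ((c + 4) * bitLength n) R, 1 ≤ n →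
        ∀ S T : Matrix (Fin n) (Fin n) R, Representable dec S T →
        ∃ r : ℕ, (r : ℝ) ≤ 2400 * (((max (nz S) (nz T) : ℕ) : ℝ) ^ ((2 : ℝ) / 3) / n + 1) ∧
          MultipliesWithin A S T r := by
    intro n R _ dec
    rcases Nat.eq_zero_or_pos n with h | h
    · exact ⟨NodeProgram.toAlgorithm fun _ _ => .ret 0, fun h' => by omega⟩
    · obtain ⟨A, hA⟩ := exists_algorithm h (pow_three_mul_two_pow_lt n c) dec
      exact ⟨A, fun _ => hA⟩
  choose SMM hSMM using hex
  -- `|κ|` allows for a negative `κ`. In the second bound N ≤ n² gives N^(2/3) / n ≤ n^(1/3), and 1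
  -- ≤ n^(1/3) doubles 2400.
  refine ⟨c + 4, SMM, fun κ => ⟨2400 * (|κ| ^ ((2 : ℝ) / 3) + 1), ?_⟩, 4800, ?_⟩
  · intro n hn R _ dec S T hrep m hS hT
    obtain ⟨r, hr, hmul⟩ := hSMM n R dec hn S T hrep
    refine ⟨r, hr.trans ?_, hmul⟩
    have hN : ((max (nz S) (nz T) : ℕ) : ℝ) ≤ |κ| * m := by
      rw [Nat.cast_max]
      exact (max_le hS hT).trans (mul_le_mul_of_nonneg_right (le_abs_self κ) (Nat.cast_nonneg m))
    have h1 : ((max (nz S) (nz T) : ℕ) : ℝ) ^ ((2 : ℝ) / 3) / n ≤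
        |κ| ^ ((2 : ℝ) / 3) * ((m : ℝ) ^ ((2 : ℝ) / 3) / n) := by
      rw [← mul_div_assoc, ← Real.mul_rpow (abs_nonneg κ) (Nat.cast_nonneg m)]
      gcongr
    have h2 : 0 ≤ |κ| ^ ((2 : ℝ) / 3) := by positivity
    have h3 : 0 ≤ (m : ℝ) ^ ((2 : ℝ) / 3) / n := by positivity
    nlinarith
  · intro n hn R _ dec S T hrep
    obtain ⟨r, hr, hmul⟩ := hSMM n R dec hn S T hrep
    refine ⟨r, hr.trans ?_, hmul⟩
    have hnR : (1 : ℝ) ≤ n := by exact_mod_cast hn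
    have hN : ((max (nz S) (nz T) : ℕ) : ℝ) ≤ (n : ℝ) ^ 2 := by
      exact_mod_cast max_le (nz_le_sq S) (nz_le_sq T)
    have h1 : ((max (nz S) (nz T) : ℕ) : ℝ) ^ ((2 : ℝ) / 3) / n ≤ (n : ℝ) ^ ((1 : ℝ) / 3) := by
      rw [div_le_iff₀ (by linarith)]
      calc ((max (nz S) (nz T) : ℕ) : ℝ) ^ ((2 : ℝ) / 3) ≤ ((n : ℝ) ^ 2) ^ ((2 : ℝ) / 3) := by
            gcongr
        _ = (n : ℝ) ^ ((1 : ℝ) / 3) * n := by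
            rw [← Real.rpow_natCast, ← Real.rpow_mul (by linarith),
              ← Real.rpow_add_one (by linarith)]
            norm_num
    have h2 : 1 ≤ (n : ℝ) ^ ((1 : ℝ) / 3) := Real.one_le_rpow hnR (by norm_num)
    linarith
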